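/- Let $k$ be a field and let $A$ be a finite-dimensional self-injective $k$-algebra. Let $A\text{-mod}$ be the category of finitely generated left $A$-modules, and let $A\text{-stab}$ be the stable category, i.e. the quotient of $A\text{-mod}$ by the maps that factor through a projective module. For finitely generated $A$-modules $M,N$ write $M\sim N$ if $M$ and $N$ are isomorphic in $A\text{-stab}$. Let $\mathcal S$ be a finite set of indecomposable finitely generated $A$-modules such that, for $S,T\in\mathcal S$, the $k$-vector space $\operatorname{Hom}_{A\text{-stab}}(S,T)$ is isomorphic to $k$ if $S=T$ and is $0$ if $S\neq T$. Call an $A$-module $M$ filtrable if there is a filtration $0=M_r\subseteq M_{r-1}\subseteq\cdots\subseteq M_0=M$ by submodules such that each quotient $M_i/M_{i+1}$ $(0\le i\le r-1)$ is isomorphic to a finite direct sum of modules belonging to $\mathcal S$. Let $M,M'_1,M'_2$ be finitely generated $A$-modules such that $M\sim M'_1\oplus M'_2$. If $M$ is filtrable, then there is a decomposition of $A$-modules $M\cong M_1\oplus M_2$ such that, for $i=1,2$, the module $M_i$ is filtrable and $M_i\sim M'_i$. -/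

import Mathlib

open CategoryTheory

universe u

namespace StableModule

section StableCategory

variable {A : Type u} [Ring A]

/-- A morphism of finitely generated `A`-modules is projective if it factors through a (finitely
generated) projective `A`-module. -/
def IsProjectiveMap {M N : FGModuleCat.{u} A} (f : M ⟶ N) : Prop :=
  ∃ P : FGModuleCat.{u} A, Module.Projective A P ∧ ∃ (g : M ⟶ P) (h : P ⟶ N), g ≫ h = f

theorem IsProjectiveMap.zero (M N : FGModuleCat.{u} A) :
    IsProjectiveMap (0 : M ⟶ N) :=
  ⟨FGModuleCat.of A PUnit.{u + 1}, (inferInstance : Module.Projective A PUnit.{u + 1}),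
    0, 0, by simp⟩

theorem IsProjectiveMap.neg {M N : FGModuleCat.{u} A} {f : M ⟶ N} (hf : IsProjectiveMap f) :
    IsProjectiveMap (-f) := by
  obtain ⟨P, hP, g, h, rfl⟩ := hf
  exact ⟨P, hP, -g, h, by simp⟩

theorem IsProjectiveMap.add {M N : FGModuleCat.{u} A} {f f' : M ⟶ N} (hf : IsProjectiveMap f)
    (hf' : IsProjectiveMap f') : IsProjectiveMap (f + f') := by
  obtain ⟨P, hP, g, h, rfl⟩ := hf
  obtain ⟨P', hP', g', h', rfl⟩ := hf'
  refine ⟨FGModuleCat.of A (P × P'), (inferInstance : Module.Projective A (P × P')),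
    FGModuleCat.ofHom (g.hom.hom.prod g'.hom.hom),
    FGModuleCat.ofHom (h.hom.hom.coprod h'.hom.hom), ?_⟩
  ext x
  rfl

theorem IsProjectiveMap.comp_left {L M N : FGModuleCat.{u} A} (e : L ⟶ M) {f : M ⟶ N}
    (hf : IsProjectiveMap f) : IsProjectiveMap (e ≫ f) := by
  obtain ⟨P, hP, g, h, rfl⟩ := hf
  exact ⟨P, hP, e ≫ g, h, by simp⟩

theorem IsProjectiveMap.comp_right {L M N : FGModuleCat.{u} A} {f : L ⟶ M} (e : M ⟶ N)
    (hf : IsProjectiveMap f) : IsProjectiveMap (f ≫ e) := by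
  obtain ⟨P, hP, g, h, rfl⟩ := hf
  exact ⟨P, hP, g, h ≫ e, by simp⟩

variable (A) in
/-- The relation `f ∼ g` on morphisms: `f - g` is a projective map. -/
def stableRel : HomRel (FGModuleCat.{u} A) := fun _ _ f g => IsProjectiveMap (f - g)

instance : Congruence (stableRel A) where
  equivalence :=
    { refl := fun f => by
        simpa [stableRel] using IsProjectiveMap.zero _ _
      symm := fun {f g} h => by
        simpa [stableRel] using IsProjectiveMap.neg h
      trans := fun {f g e} h h' => by
        simpa [stableRel] using IsProjectiveMap.add h h' }
  comp_left e f g h := by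
    simpa [stableRel] using IsProjectiveMap.comp_left e h
  comp_right e h := by
    simpa [stableRel] using IsProjectiveMap.comp_right e h

theorem stableRel_add ⦃M N : FGModuleCat.{u} A⦄ (f₁ f₂ g₁ g₂ : M ⟶ N)
    (hf : stableRel A f₁ f₂) (hg : stableRel A g₁ g₂) :
    stableRel A (f₁ + g₁) (f₂ + g₂) := by
  have h := IsProjectiveMap.add hf hg
  rwa [sub_add_sub_comm] at h

variable (A) in
/-- The stable category `A-stab`: the quotient of the category of finitely generated (left)
`A`-modules by the maps which factor through a projective module. -/
abbrev Stab : Type (u + 1) := CategoryTheory.Quotient (stableRel A)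

instance : Preadditive (Stab A) := Quotient.preadditive (stableRel A) stableRel_add

instance : (Quotient.functor (stableRel A)).Additive :=
  Quotient.functor_additive (stableRel A) stableRel_add

/-- A finitely generated `A`-module, viewed as an object of the stable category. -/
abbrev toStab (M : FGModuleCat.{u} A) : Stab A := (Quotient.functor (stableRel A)).obj M

/-- `M ∼ N`: the modules `M` and `N` are isomorphic in the stable category. -/
def StablyIso (M N : FGModuleCat.{u} A) : Prop := Nonempty (toStab M ≅ toStab N)

/-- The direct sum of two finitely generated `A`-modules. -/
abbrev directSum (M N : FGModuleCat.{u} A) : FGModuleCat.{u} A := FGModuleCat.of A (M × N)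

end StableCategory

section Linear

variable (k : Type*) [Field k] {A : Type u} [Ring A] [Algebra k A]

theorem stableRel_smul (a : k) ⦃M N : FGModuleCat.{u} A⦄ (f₁ f₂ : M ⟶ N)
    (h : stableRel A f₁ f₂) : stableRel A (a • f₁) (a • f₂) := by
  obtain ⟨P, hP, g, h, e⟩ := h
  exact ⟨P, hP, a • g, h, by rw [Linear.smul_comp, e, smul_sub]⟩

/-- The `k`-linear structure of the stable category induced by that of the category of
`A`-modules. -/
instance : Linear k (Stab A) := Quotient.linear k (stableRel A) (stableRel_smul k)

end Linear

section Filtrable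

variable {A : Type u} [Ring A] {ι : Type*}

/-- `X` lies in `add(𝒮)`, where `𝒮` is the set of the modules `S i`: it is isomorphic to a
finite direct sum of modules of `𝒮`. -/
def InAdd (S : ι → FGModuleCat.{u} A) (X : Type*) [AddCommGroup X] [Module A X] : Prop :=
  ∃ (n : ℕ) (s : Fin n → ι), Nonempty (X ≃ₗ[A] ((j : Fin n) → S (s j)))

/-- `M` is filtrable: there is a filtration `0 = F r ⊆ F (r - 1) ⊆ ⋯ ⊆ F 0 = M` by submodules
all of whose subquotients `F i / F (i + 1)` are in `add(𝒮)`. -/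
def Filtrable (S : ι → FGModuleCat.{u} A) (M : Type*) [AddCommGroup M] [Module A M] : Prop :=
  ∃ (r : ℕ) (F : ℕ → Submodule A M), F 0 = ⊤ ∧ F r = ⊥ ∧
    ∀ i < r, F (i + 1) ≤ F i ∧ InAdd S (F i ⧸ (F (i + 1)).submoduleOf (F i))

/-- The hypothesis on the set `𝒮` of the modules `S i`: each `S i` is an indecomposable (finitely
generated) `A`-module, and `Hom(S i, S j)` in the stable category is `k` if `i = j`, and `0`
otherwise. -/
structure IsStableSimpleFamily (k : Type*) [Field k] [Algebra k A] (S : ι → FGModuleCat.{u} A) :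
    Prop where
  indecomposable : ∀ i, Indecomposable (S i).obj
  hom_self : ∀ i, Nonempty ((toStab (S i) ⟶ toStab (S i)) ≃ₗ[k] k)
  hom_ne : ∀ i j, i ≠ j → Subsingleton (toStab (S i) ⟶ toStab (S j))

end Filtrable

end StableModule

/-! The decomposition of `M` in the stable category is recorded by a stable idempotent `e`, so it
suffices to lift `e` to a genuine idempotent with filtered kernel and image
(`FiltLength.liftsIdempotents`).

Since free modules are projective and, `A` being self-injective, also injective, stably zero maps
can be lifted along surjections and extended along injections. With the stable Schur lemma this
shows that every stably nonzero `f : M → S j` is stably equal to a surjection with filtered,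
strictly shorter kernel `K` (`FiltLength.exists_surjective`). If `f ∘ e` is stably zero, `e` can be
corrected to land in `K`; it induces a stable idempotent there, which lifts by induction on the
length, and the lift extends to `M` (`exists_idempotent_of_ker`). Such an `f` exists for `e` or for
`1 - e`, unless every map from `M` to the family is stably zero; then `e` is stably zero. -/

namespace StableModule

/-! ### Stably zero maps and stable equality -/

section StablyZero

variable {A : Type u} [Ring A] {L M N : Type u} [AddCommGroup L] [Module A L] [AddCommGroup M]
  [Module A M] [AddCommGroup N] [Module A N]

/-- A linear map is stably zero if it factors through a free module of finite rank. -/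
def StablyZero (f : M →ₗ[A] N) : Prop :=
  ∃ (n : ℕ) (g : M →ₗ[A] (Fin n → A)) (h : (Fin n → A) →ₗ[A] N), h ∘ₗ g = f

theorem StablyZero.zero : StablyZero (0 : M →ₗ[A] N) := ⟨0, 0, 0, by simp⟩

theorem StablyZero.comp_left {f : M →ₗ[A] N} (hf : StablyZero f) (e : N →ₗ[A] L) :
    StablyZero (e ∘ₗ f) := by
  obtain ⟨n, g, h, rfl⟩ := hf
  exact ⟨n, g, e ∘ₗ h, rfl⟩

theorem StablyZero.comp_right {f : M →ₗ[A] N} (hf : StablyZero f) (e : L →ₗ[A] M) :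
    StablyZero (f ∘ₗ e) := by
  obtain ⟨n, g, h, rfl⟩ := hf
  exact ⟨n, g ∘ₗ e, h, rfl⟩

theorem StablyZero.neg {f : M →ₗ[A] N} (hf : StablyZero f) : StablyZero (-f) := by
  obtain ⟨n, g, h, rfl⟩ := hf
  exact ⟨n, -g, h, by simp⟩

/-- A finitely generated projective module is a retract of some `A ^ n`. -/
theorem isProjectiveMap_iff_stablyZero {M N : FGModuleCat.{u} A} (f : M ⟶ N) :
    IsProjectiveMap f ↔ StablyZero f.hom.hom := by
  constructor
  · rintro ⟨P, hP, g, h, rfl⟩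
    obtain ⟨n, a, b, -, -, hab⟩ := Module.Finite.exists_comp_eq_id_of_projective A P
    refine ⟨n, b ∘ₗ g.hom.hom, h.hom.hom ∘ₗ a, ?_⟩
    ext x
    exact congrArg h.hom.hom (LinearMap.congr_fun hab (g.hom.hom x))
  · rintro ⟨n, g, h, e⟩
    refine ⟨FGModuleCat.of A (Fin n → A), (inferInstance : Module.Projective A (Fin n → A)),
      FGModuleCat.ofHom g, FGModuleCat.ofHom h, ?_⟩
    ext x
    exact LinearMap.congr_fun e x

theorem StablyZero.add {f g : M →ₗ[A] N} (hf : StablyZero f) (hg : StablyZero g) :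
    StablyZero (f + g) := by
  obtain ⟨m, a, b, rfl⟩ := hf
  obtain ⟨n, c, d, rfl⟩ := hg
  let e : ((Fin m → A) × (Fin n → A)) ≃ₗ[A] (Fin (m + n) → A) :=
    (LinearEquiv.sumArrowLequivProdArrow (Fin m) (Fin n) A A).symm ≪≫ₗ
      LinearEquiv.funCongrLeft A A finSumFinEquiv.symm
  refine ⟨m + n, e.toLinearMap ∘ₗ a.prod c, b.coprod d ∘ₗ e.symm.toLinearMap, ?_⟩
  ext x
  simp

/-- `A ^ n` is injective because `A` is; this is where self-injectivity enters. -/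
theorem StablyZero.extend (hA : Module.Injective A A) {i : L →ₗ[A] M}
    (hi : Function.Injective i) {f : L →ₗ[A] N} (hf : StablyZero f) :
    ∃ f' : M →ₗ[A] N, StablyZero f' ∧ f' ∘ₗ i = f := by
  obtain ⟨n, g, h, rfl⟩ := hf
  obtain ⟨g', rfl⟩ := Module.Injective.extension_property A (Fin n → A) L M i hi g
  exact ⟨h ∘ₗ g', ⟨n, g', h, rfl⟩, rfl⟩

theorem StablyZero.lift {p : M →ₗ[A] N} (hp : Function.Surjective p) {f : L →ₗ[A] N}
    (hf : StablyZero f) : ∃ f' : L →ₗ[A] M, StablyZero f' ∧ p ∘ₗ f' = f := by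
  obtain ⟨n, g, h, rfl⟩ := hf
  obtain ⟨h', rfl⟩ := Module.projective_lifting_property p h hp
  exact ⟨h' ∘ₗ g, ⟨n, g, h', rfl⟩, rfl⟩

/-- Two linear maps are stably equal if their difference is stably zero. -/
def StablyEq (f g : M →ₗ[A] N) : Prop := StablyZero (f - g)

theorem StablyEq.refl (f : M →ₗ[A] N) : StablyEq f f := by
  simpa [StablyEq] using StablyZero.zero

theorem StablyEq.symm {f g : M →ₗ[A] N} (h : StablyEq f g) : StablyEq g f := by
  simpa [StablyEq] using StablyZero.neg h

theorem StablyEq.trans {f g h : M →ₗ[A] N} (h₁ : StablyEq f g) (h₂ : StablyEq g h) :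
    StablyEq f h := by
  simpa [StablyEq] using StablyZero.add h₁ h₂

instance : Trans (StablyEq (A := A) (M := M) (N := N)) (StablyEq (A := A) (M := M) (N := N))
    (StablyEq (A := A) (M := M) (N := N)) := ⟨StablyEq.trans⟩

theorem StablyEq.sub {f g f' g' : M →ₗ[A] N} (h : StablyEq f g) (h' : StablyEq f' g') :
    StablyEq (f - f') (g - g') := by
  have := StablyZero.add h (StablyZero.neg h')
  rwa [show f - g + -(f' - g') = f - f' - (g - g') by abel] at this

theorem StablyEq.comp {g g' : M →ₗ[A] N} {f f' : L →ₗ[A] M} (hg : StablyEq g g')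
    (hf : StablyEq f f') : StablyEq (g ∘ₗ f) (g' ∘ₗ f') := by
  have := (StablyZero.comp_left hf g).add (StablyZero.comp_right hg f')
  rwa [LinearMap.comp_sub, LinearMap.sub_comp, sub_add_sub_cancel] at this

theorem stablyEq_zero {f : M →ₗ[A] N} : StablyEq f 0 ↔ StablyZero f := by
  simp [StablyEq]

theorem StablyZero.congr {f g : M →ₗ[A] N} (hf : StablyZero f) (h : StablyEq f g) :
    StablyZero g :=
  stablyEq_zero.1 (h.symm.trans (stablyEq_zero.2 hf))

end StablyZero

/-! ### Filtrations with one module of the family at each step -/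

section FiltLength

variable {A : Type u} [Ring A] {ι : Type*} (S : ι → FGModuleCat.{u} A)

/-- `M` has a filtration of length `n` all of whose subquotients are isomorphic to modules
`S i`. -/
def FiltLength : ℕ → ∀ (M : Type u) [AddCommGroup M] [Module A M], Prop
  | 0, M, _, _ => Subsingleton M
  | n + 1, M, _, _ => ∃ (i : ι) (f : M →ₗ[A] S i), Function.Surjective f ∧
      FiltLength n (LinearMap.ker f)

variable {S} {M N : Type u} [AddCommGroup M] [Module A M] [AddCommGroup N] [Module A N]

theorem FiltLength.of_equiv {n : ℕ} (h : FiltLength S n M) (e : M ≃ₗ[A] N) :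
    FiltLength S n N := by
  induction n generalizing M N with
  | zero => exact e.symm.toEquiv.subsingleton_congr.2 h
  | succ n ih =>
    obtain ⟨i, f, hf, hk⟩ := h
    refine ⟨i, f ∘ₗ e.symm.toLinearMap, hf.comp e.symm.surjective, ih hk ?_⟩
    rw [LinearMap.ker_comp]
    exact (e.symm.ofSubmodule' (LinearMap.ker f)).symm

theorem FiltLength.of_exact {n : ℕ} (h : FiltLength S n N) {g : N →ₗ[A] M}
    (hg : Function.Injective g) {i : ι} {f : M →ₗ[A] S i} (hf : Function.Surjective f)
    (hgf : LinearMap.range g = LinearMap.ker f) : FiltLength S (n + 1) M :=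
  ⟨i, f, hf, h.of_equiv (LinearEquiv.ofInjective g hg ≪≫ₗ LinearEquiv.ofEq _ _ hgf)⟩

/-- Refines one layer in `add(𝒮)` by splitting off the summands one at a time. -/
theorem FiltLength.of_surjective_pi {m n : ℕ} (s : Fin n → ι)
    (f : M →ₗ[A] ((j : Fin n) → S (s j))) (hf : Function.Surjective f)
    (hk : FiltLength S m (LinearMap.ker f)) : FiltLength S (m + n) M := by
  induction n generalizing M with
  | zero =>
    refine hk.of_equiv (LinearEquiv.ofTop _ ?_)
    rw [LinearMap.ker_eq_top]
    ext x j
    exact j.elim0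
  | succ n ih =>
    have h0 : Function.Surjective (LinearMap.proj 0 ∘ₗ f : M →ₗ[A] S (s 0)) :=
      (Function.surjective_eval 0).comp hf
    refine ⟨s 0, LinearMap.proj 0 ∘ₗ f, h0, ?_⟩
    refine ih (fun j => s j.succ)
      (LinearMap.pi fun j => LinearMap.proj j.succ ∘ₗ f ∘ₗ Submodule.subtype _) ?_ ?_
    · intro y
      obtain ⟨x, hx⟩ := hf (Fin.cons 0 y)
      refine ⟨⟨x, ?_⟩, ?_⟩
      · simp [hx]
      · ext j
        simp [hx]
    · refine hk.of_equiv ?_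
      refine LinearEquiv.ofLinearMap
        (((Submodule.subtype _).codRestrict _ ?_).codRestrict _ ?_)
        ((Submodule.subtype _ ∘ₗ Submodule.subtype _).codRestrict _ ?_) ?_ ?_
      · rintro ⟨x, hx⟩
        rw [LinearMap.mem_ker] at hx
        simp [hx]
      · rintro ⟨x, hx⟩
        rw [LinearMap.mem_ker] at hx
        rw [LinearMap.mem_ker]
        ext j
        simp [hx]
      · rintro ⟨⟨x, hx⟩, hx'⟩
        rw [LinearMap.mem_ker]
        ext j
        refine Fin.cases ?_ (fun j => ?_) j
        · exact hx
        · exact congrFun hx' j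
      · rfl
      · rfl

theorem Filtrable.exists_filtLength (h : Filtrable S M) : ∃ n, FiltLength S n M := by
  obtain ⟨r, F, h0, hr, hF⟩ := h
  -- The filtration is decreasing, so the induction climbs from `F r = ⊥` to `F 0 = ⊤`.
  have key : ∀ j ≤ r, ∃ n, FiltLength S n (F (r - j)) := by
    intro j
    induction j with
    | zero =>
      intro _
      refine ⟨0, ?_⟩
      rw [Nat.sub_zero, hr]
      exact (inferInstance : Subsingleton (⊥ : Submodule A M))
    | succ j ih =>
      intro hj
      obtain ⟨m, hm⟩ := ih (by omega)
      obtain ⟨hle, n, s, ⟨e⟩⟩ := hF (r - (j + 1)) (by omega)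
      rw [show r - j = r - (j + 1) + 1 by omega] at hm
      refine ⟨_, FiltLength.of_surjective_pi s (e.toLinearMap ∘ₗ Submodule.mkQ _)
        (e.surjective.comp (Submodule.mkQ_surjective _)) (hm.of_equiv ?_)⟩
      refine (Submodule.submoduleOfEquivOfLe hle).symm ≪≫ₗ LinearEquiv.ofEq _ _ ?_
      rw [LinearEquiv.ker_comp, Submodule.ker_mkQ]
  obtain ⟨n, hn⟩ := key r le_rfl
  rw [Nat.sub_self, h0] at hn
  exact ⟨n, hn.of_equiv Submodule.topEquiv⟩

theorem InAdd.of_equiv {X Y : Type*} [AddCommGroup X] [Module A X] [AddCommGroup Y] [Module A Y]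
    (h : InAdd S X) (e : X ≃ₗ[A] Y) : InAdd S Y := by
  obtain ⟨n, s, ⟨e'⟩⟩ := h
  exact ⟨n, s, ⟨e.symm ≪≫ₗ e'⟩⟩

theorem inAdd_self (i : ι) : InAdd S (S i) :=
  ⟨1, fun _ => i, ⟨(LinearEquiv.funUnique (Fin 1) A (S i)).symm⟩⟩

theorem FiltLength.filtrable {n : ℕ} (h : FiltLength S n M) : Filtrable S M := by
  induction n generalizing M with
  | zero =>
    have : Subsingleton M := h
    exact ⟨0, fun _ => ⊤, rfl, Subsingleton.elim _ _, by simp⟩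
  | succ n ih =>
    obtain ⟨i, f, hf, hk⟩ := h
    obtain ⟨r, F, h0, hr, hF⟩ := ih hk
    let G : ℕ → Submodule A M
      | 0 => ⊤
      | j + 1 => (F j).map (Submodule.subtype _)
    refine ⟨r + 1, G, rfl, by simp [G, hr], ?_⟩
    rintro (_ | j) hj
    · refine ⟨le_top, (inAdd_self i).of_equiv (LinearEquiv.symm ?_)⟩
      refine Submodule.quotEquivOfEq _ (LinearMap.ker (f ∘ₗ Submodule.subtype ⊤)) ?_ ≪≫ₗ
        LinearMap.quotKerEquivOfSurjective _ ?_
      · ext x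
        simp [G, h0, Submodule.submoduleOf]
      · intro y
        obtain ⟨x, rfl⟩ := hf y
        exact ⟨⟨x, trivial⟩, rfl⟩
    · obtain ⟨hle, hadd⟩ := hF j (by omega)
      refine ⟨Submodule.map_mono hle, hadd.of_equiv ?_⟩
      refine Submodule.Quotient.equiv _ _
        (Submodule.equivMapOfInjective _ (Submodule.subtype_injective _) (F j)) ?_
      ext ⟨x, hx⟩
      constructor
      · rintro ⟨y, hy, hyx⟩
        exact ⟨y.1, hy, congrArg Subtype.val hyx⟩
      · rintro ⟨y, hy, hyx⟩
        exact ⟨⟨y, hle hy⟩, hy, Subtype.ext hyx⟩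

end FiltLength

/-! ### Schur's lemma and lifting of stable idempotents -/

section Family

variable {A : Type u} [Ring A] {ι : Type*} {S : ι → FGModuleCat.{u} A}

/-- Schur's lemma: a map between two modules of the family which is not stably zero is stably equal
to an isomorphism. -/
theorem IsStableSimpleFamily.exists_equiv {k : Type*} [Field k] [Algebra k A]
    (hS : IsStableSimpleFamily k S) {i j : ι} (c : S i →ₗ[A] S j) (hc : ¬ StablyZero c) :
    ∃ d : S i ≃ₗ[A] S j, StablyEq c d.toLinearMap := by
  have map_ne {j : ι} (c : S i →ₗ[A] S j) (hc : ¬ StablyZero c) :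
      (Quotient.functor (stableRel A)).map (FGModuleCat.ofHom c : S i ⟶ S j) ≠ 0 := by
    intro h
    rw [← Functor.map_zero, Quotient.functor_map_eq_iff] at h
    refine hc ((isProjectiveMap_iff_stablyZero (FGModuleCat.ofHom c : S i ⟶ S j)).1 ?_)
    simpa [stableRel] using h
  by_cases hij : i = j
  · subst hij
    obtain ⟨φ⟩ := hS.hom_self i
    -- The identity thus spans the one-dimensional stable endomorphism space, so `c` is stably a
    -- nonzero scalar.
    have hid : ¬ StablyZero (LinearMap.id : S i →ₗ[A] S i) := fun h => hc (h.comp_left c)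
    set x := (Quotient.functor (stableRel A)).map (FGModuleCat.ofHom c : S i ⟶ S i) with hx
    set y := (Quotient.functor (stableRel A)).map
      (FGModuleCat.ofHom (LinearMap.id : S i →ₗ[A] S i) : S i ⟶ S i) with hy
    have hx0 : φ x ≠ 0 := fun h => map_ne c hc (φ.map_eq_zero_iff.1 h)
    have hy0 : φ y ≠ 0 := fun h => map_ne _ hid (φ.map_eq_zero_iff.1 h)
    set a : k := φ x / φ y with ha
    have ha0 : a ≠ 0 := div_ne_zero hx0 hy0
    have hxy : x = a • y := by
      apply φ.injective
      rw [map_smul, smul_eq_mul, ha, div_mul_cancel₀ _ hy0]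
    have hrel : stableRel A (FGModuleCat.ofHom c : S i ⟶ S i) (a • 𝟙 (S i)) :=
      (Quotient.functor_map_eq_iff (stableRel A) _ _).1 hxy
    let d : S i ≅ S i := ⟨a • 𝟙 (S i), a⁻¹ • 𝟙 (S i), by simp [smul_smul, ha0],
      by simp [smul_smul, ha0]⟩
    refine ⟨((forget₂ (FGModuleCat A) (ModuleCat A)).mapIso d).toLinearEquiv, ?_⟩
    exact (isProjectiveMap_iff_stablyZero _).1 hrel
  · have := hS.hom_ne i j hij
    exact absurd (Subsingleton.elim _ _) (map_ne c hc)

variable {M N : Type u} [AddCommGroup M] [Module A M] [AddCommGroup N] [Module A N]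

/-- A map from a filtered module to a module of the family which is not stably zero is stably equal
to a surjective map whose kernel has a shorter filtration. -/
theorem FiltLength.exists_surjective (hA : Module.Injective A A)
    (hSchur : ∀ i j (c : S i →ₗ[A] S j), ¬ StablyZero c →
      ∃ d : S i ≃ₗ[A] S j, StablyEq c d.toLinearMap)
    {n : ℕ} (h : FiltLength S n M) {j : ι} (f : M →ₗ[A] S j) (hf : ¬ StablyZero f) :
    ∃ (m : ℕ) (f' : M →ₗ[A] S j), n = m + 1 ∧ StablyEq f f' ∧ Function.Surjective f' ∧
      FiltLength S m (LinearMap.ker f') := by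
  induction n generalizing M with
  | zero =>
    have : Subsingleton M := h
    refine absurd ?_ hf
    rw [show f = 0 from LinearMap.ext fun x => by rw [Subsingleton.elim x 0]; simp]
    exact StablyZero.zero
  | succ n ih =>
    obtain ⟨i, p, hp, hk⟩ := h
    have hinj := (LinearMap.ker p).subtype_injective
    by_cases hz : StablyZero (f ∘ₗ (LinearMap.ker p).subtype)
    -- After subtracting `w`, the map kills `ker p` and factors through `p`; Schur's lemma applies
    -- to the factor.
    · obtain ⟨w, hw, hwf⟩ := hz.extend hA hinj
      obtain ⟨c, hc⟩ : ∃ c : S i →ₗ[A] S j, c ∘ₗ p = f - w := by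
        refine ⟨(LinearMap.ker p).liftQ (f - w) ?_ ∘ₗ
          (p.quotKerEquivOfSurjective hp).symm.toLinearMap, ?_⟩
        · intro x hx
          have := LinearMap.congr_fun hwf ⟨x, hx⟩
          simp only [LinearMap.comp_apply, Submodule.subtype_apply] at this
          simp [this]
        · ext x
          have : (p.quotKerEquivOfSurjective hp).symm (p x) = (LinearMap.ker p).mkQ x := by
            rw [LinearEquiv.symm_apply_eq]
            rfl
          simp [this]
      have hfc : StablyEq f (c ∘ₗ p) := by
        rw [hc]
        simpa [StablyEq] using hw
      obtain ⟨d, hd⟩ := hSchur i j c fun h => hf ((h.comp_right p).congr hfc.symm)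
      refine ⟨n, d.toLinearMap ∘ₗ p, rfl, hfc.trans (hd.comp (.refl p)), d.surjective.comp hp, ?_⟩
      rwa [LinearEquiv.ker_comp]
    · obtain ⟨m, f', rfl, hff', hf's, hf'k⟩ := ih hk _ hz
      obtain ⟨w, hw, hwf⟩ := StablyZero.extend hA hinj hff'
      have hres (x) (hx : p x = 0) : f x - w x = f' ⟨x, hx⟩ := by
        have := LinearMap.congr_fun hwf ⟨x, hx⟩
        simp only [LinearMap.comp_apply, Submodule.subtype_apply, LinearMap.sub_apply] at this
        simp [this]
      refine ⟨m + 1, f - w, rfl, by simpa [StablyEq] using hw, fun y => ?_, ?_⟩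
      · obtain ⟨⟨x, hx⟩, rfl⟩ := hf's y
        exact ⟨x, hres x hx⟩
      -- `ker (f - w)` maps onto `S i` by `p`, with kernel `ker f'`, since `f - w` restricts to `f'`
      -- on `ker p`.
      · refine hf'k.of_exact (i := i)
          (g := ((LinearMap.ker p).subtype ∘ₗ (LinearMap.ker f').subtype).codRestrict _ ?_)
          (f := p ∘ₗ (LinearMap.ker (f - w)).subtype) ?_ ?_ ?_
        · rintro ⟨⟨x, hx⟩, hx'⟩
          exact (hres x hx).trans hx'
        · intro x y hxy
          have h : x.1.1 = y.1.1 := congrArg (LinearMap.ker (f - w)).subtype hxy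
          exact Subtype.ext (Subtype.ext h)
        · intro y
          obtain ⟨x, rfl⟩ := hp y
          obtain ⟨⟨z, hz⟩, hzx⟩ := hf's ((f - w) x)
          have hz' : p z = 0 := hz
          refine ⟨⟨x - z, ?_⟩, ?_⟩
          · have := hres z hz
            rw [LinearMap.mem_ker, map_sub, ← hzx, ← this]
            simp
          · simp [hz']
        · ext ⟨x, hx⟩
          constructor
          · rintro ⟨⟨⟨z, hz⟩, hz'⟩, hzx⟩
            obtain rfl : z = x := congrArg Subtype.val hzx
            exact hz
          · intro hpx
            exact ⟨⟨⟨x, hpx⟩, (hres x hpx).symm.trans hx⟩, rfl⟩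

/-- Subtracting a stably zero lift of `p ∘ f` pushes `f` into `ker p`, one layer down. -/
theorem FiltLength.stablyZero {n : ℕ} (h : FiltLength S n N)
    (hM : ∀ i (f : M →ₗ[A] S i), StablyZero f) (f : M →ₗ[A] N) : StablyZero f := by
  induction n generalizing N with
  | zero =>
    have : Subsingleton N := h
    rw [show f = 0 from LinearMap.ext fun x => Subsingleton.elim _ _]
    exact StablyZero.zero
  | succ n ih =>
    obtain ⟨i, p, hp, hk⟩ := h
    obtain ⟨w, hw, hwf⟩ := (hM i (p ∘ₗ f)).lift hp
    have := (ih hk ((f - w).codRestrict (LinearMap.ker p) fun x => by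
      have := LinearMap.congr_fun hwf x
      simp only [LinearMap.comp_apply] at this
      simp [this])).comp_left (LinearMap.ker p).subtype
    rw [LinearMap.subtype_comp_codRestrict] at this
    exact this.congr (by simpa [StablyEq] using hw.neg)

variable (S) in
/-- Every stable idempotent of `M` is stably equal to an idempotent whose kernel and image (the
kernel of the complementary idempotent) are filtered. -/
def LiftsIdempotents (M : Type u) [AddCommGroup M] [Module A M] : Prop :=
  ∀ e : M →ₗ[A] M, StablyEq (e ∘ₗ e) e → ∃ q : M →ₗ[A] M, q ∘ₗ q = q ∧ StablyEq q e ∧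
    (∃ m, FiltLength S m (LinearMap.ker q)) ∧ ∃ m, FiltLength S m (LinearMap.ker (.id - q))

theorem exists_idempotent_of_ker (hA : Module.Injective A A) {i : ι} {f : M →ₗ[A] S i}
    (hf : Function.Surjective f) (hK : LiftsIdempotents S (LinearMap.ker f)) {e₀ : M →ₗ[A] M}
    (he₀ : StablyEq (e₀ ∘ₗ e₀) e₀) (hfe₀ : StablyZero (f ∘ₗ e₀)) :
    ∃ q : M →ₗ[A] M, q ∘ₗ q = q ∧ StablyEq q e₀ ∧
      (∃ m, FiltLength S m (LinearMap.ker q)) ∧ ∃ m, FiltLength S m (LinearMap.ker (.id - q)) := by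
  obtain ⟨w, hw, hwf⟩ := hfe₀.lift hf
  set e := e₀ - w with he_def
  have hee₀ : StablyEq e e₀ := by simpa [StablyEq, he_def] using hw.neg
  have hfe (x) : f (e x) = 0 := by
    have := LinearMap.congr_fun hwf x
    simp only [LinearMap.comp_apply] at this
    simp [he_def, this]
  have he : StablyEq (e ∘ₗ e) e := (hee₀.comp hee₀).trans (he₀.trans hee₀.symm)
  set I := (LinearMap.ker f).subtype
  have hIinj : Function.Injective I := (LinearMap.ker f).subtype_injective
  let u₀ : M →ₗ[A] LinearMap.ker f := e.codRestrict _ hfe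
  have hIu₀ : I ∘ₗ u₀ = e := LinearMap.subtype_comp_codRestrict _ _ _
  -- The extra factor `e` matters: `I` need not be cancellable stably, so `u₀ ∘ I` need not be a
  -- stable idempotent, whereas `(u ∘ I)² = u₀ ∘ e³ ∘ I`.
  let u := u₀ ∘ₗ e
  have hIu : I ∘ₗ u = e ∘ₗ e := by rw [← LinearMap.comp_assoc, hIu₀]
  have huI : StablyEq ((u ∘ₗ I) ∘ₗ (u ∘ₗ I)) (u ∘ₗ I) := by
    have h1 : (u ∘ₗ I) ∘ₗ (u ∘ₗ I) = u₀ ∘ₗ (e ∘ₗ (e ∘ₗ e)) ∘ₗ I := by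
      rw [← hIu]
      rfl
    rw [h1]
    have h2 : StablyEq (e ∘ₗ (e ∘ₗ e)) e := ((StablyEq.refl e).comp he).trans he
    exact (StablyEq.refl u₀).comp (h2.comp (.refl I))
  obtain ⟨p, hpp, hpu, ⟨m₁, hm₁⟩, ⟨m₂, hm₂⟩⟩ := hK _ huI
  have hz : StablyEq (p ∘ₗ u ∘ₗ I) p := by
    have := (StablyEq.refl p).comp hpu.symm
    rwa [hpp] at this
  obtain ⟨v, hv, hvI⟩ := StablyZero.extend hA hIinj hz
  -- The correction `v` makes `ρ` extend `p` exactly, so `I ∘ ρ` is a genuine idempotent with the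
  -- image of `p`.
  set ρ := p ∘ₗ (u - v) with hρ
  have hpp' (x) : p (p x) = p x := LinearMap.congr_fun hpp x
  have hρI (x) : ρ (I x) = p x := by
    have := LinearMap.congr_fun hvI x
    simp only [LinearMap.comp_apply, LinearMap.sub_apply] at this
    simp [hρ, this, hpp']
  have hpρ (x) : p (ρ x) = ρ x := hpp' _
  have hIρ (x) : f (I (ρ x)) = 0 := (ρ x).2
  refine ⟨I ∘ₗ ρ, ?_, ?_, ⟨m₁ + 1, ?_⟩, ⟨m₂, ?_⟩⟩
  · ext x
    simp only [LinearMap.comp_apply, hρI, hpρ]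
  · have h1 : StablyEq (I ∘ₗ ρ) (I ∘ₗ (u ∘ₗ I) ∘ₗ u) :=
      (StablyEq.refl I).comp (hpu.comp (by simpa [StablyEq] using hv.neg))
    have h2 : I ∘ₗ (u ∘ₗ I) ∘ₗ u = (e ∘ₗ e) ∘ₗ (e ∘ₗ e) := by
      rw [← hIu]
      rfl
    rw [h2] at h1
    exact h1.trans ((he.comp he).trans (he.trans hee₀))
  -- The kernel of the new idempotent is an extension of `S i` by `ker p`.
  · refine hm₁.of_exact (i := i) (g := (I ∘ₗ (LinearMap.ker p).subtype).codRestrict _ ?_)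
      (f := f ∘ₗ (LinearMap.ker (I ∘ₗ ρ)).subtype) ?_ ?_ ?_
    · rintro ⟨x, hx⟩
      have hx' : p x = 0 := hx
      simp [hρI, hx']
    · intro x y hxy
      have h : I x.1 = I y.1 := congrArg (LinearMap.ker (I ∘ₗ ρ)).subtype hxy
      exact Subtype.ext (hIinj h)
    · intro y
      obtain ⟨x, rfl⟩ := hf y
      refine ⟨⟨x - I (ρ x), ?_⟩, ?_⟩
      · simp [hρI, hpρ]
      · simp [hIρ]
    · ext ⟨x, hx⟩
      constructor
      · rintro ⟨⟨z, hz⟩, hzx⟩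
        obtain rfl : I z = x := congrArg Subtype.val hzx
        exact z.2
      · intro hfx
        refine ⟨⟨⟨x, hfx⟩, ?_⟩, rfl⟩
        rw [LinearMap.mem_ker, ← hρI]
        exact hIinj (hx.trans I.map_zero.symm)
  · refine hm₂.of_equiv (Submodule.equivMapOfInjective I hIinj _ ≪≫ₗ LinearEquiv.ofEq _ _ ?_)
    ext x
    simp only [Submodule.mem_map, LinearMap.mem_ker, LinearMap.sub_apply, LinearMap.id_apply,
      LinearMap.comp_apply, sub_eq_zero]
    constructor
    · rintro ⟨y, hy, rfl⟩
      rw [hρI, ← hy]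
    · intro hx
      exact ⟨ρ x, (hpρ x).symm, hx.symm⟩

theorem FiltLength.liftsIdempotents (hA : Module.Injective A A)
    (hSchur : ∀ i j (c : S i →ₗ[A] S j), ¬ StablyZero c →
      ∃ d : S i ≃ₗ[A] S j, StablyEq c d.toLinearMap)
    {n : ℕ} (h : FiltLength S n M) : LiftsIdempotents S M := by
  induction n using Nat.strong_induction_on generalizing M with
  | h n ih =>
    intro e he
    have step {e : M →ₗ[A] M} (he : StablyEq (e ∘ₗ e) e) {i : ι} (f : M →ₗ[A] S i)
        (hf : ¬ StablyZero f) (hfe : StablyZero (f ∘ₗ e)) :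
        ∃ q : M →ₗ[A] M, q ∘ₗ q = q ∧ StablyEq q e ∧ (∃ m, FiltLength S m (LinearMap.ker q)) ∧
          ∃ m, FiltLength S m (LinearMap.ker (.id - q)) := by
      obtain ⟨m, f', rfl, hff', hf', hk⟩ := h.exists_surjective hA hSchur f hf
      exact exists_idempotent_of_ker hA hf' (ih m (by omega) hk) he
        (hfe.congr (hff'.comp (.refl e)))
    by_cases h₁ : ∀ i (g : M →ₗ[A] S i), StablyZero (g ∘ₗ (.id - e))
    · by_cases h₂ : ∀ i (g : M →ₗ[A] S i), StablyZero (g ∘ₗ e)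
      · have hz : StablyZero e := by
          refine h.stablyZero (fun i f => ?_) e
          have := (h₁ i f).add (h₂ i f)
          rwa [← LinearMap.comp_add, sub_add_cancel, LinearMap.comp_id] at this
        refine ⟨0, by simp, (stablyEq_zero.2 hz).symm, ⟨n, h.of_equiv ?_⟩, ⟨0, ?_⟩⟩
        · rw [LinearMap.ker_zero]
          exact Submodule.topEquiv.symm
        · rw [sub_zero, LinearMap.ker_id]
          exact (inferInstance : Subsingleton (⊥ : Submodule A M))
      · push Not at h₂
        obtain ⟨i, g, hg⟩ := h₂
        have he' : StablyEq ((.id - e) ∘ₗ (.id - e)) (.id - e) := by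
          have : (.id - e) ∘ₗ (.id - e) - (.id - e) = e ∘ₗ e - e := by
            ext x
            simp
          rw [StablyEq, this]
          exact he
        -- Here `1 - e` is lifted instead; the complement of the lift serves for `e`.
        obtain ⟨q, hqq, hqe, hq₁, hq₂⟩ := step he' (g ∘ₗ e) hg (h₁ i (g ∘ₗ e))
        have hqq' (x) : q (q x) = q x := LinearMap.congr_fun hqq x
        refine ⟨.id - q, ?_, ?_, hq₂, ?_⟩
        · ext x
          simp [hqq']
        · simpa using (StablyEq.refl .id).sub hqe
        · rwa [sub_sub_cancel]
    · push Not at h₁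
      obtain ⟨i, g, hg⟩ := h₁
      refine step he (g ∘ₗ (.id - e)) hg ?_
      have : (g ∘ₗ (.id - e)) ∘ₗ e = -(g ∘ₗ (e ∘ₗ e - e)) := by
        ext x
        simp
      rw [this]
      exact (StablyZero.comp_left he g).neg

end Family

/-! ### From stable isomorphisms to decompositions -/

section Assembly

variable {A : Type u} [Ring A]

theorem stableRel_iff_stablyEq {M N : FGModuleCat.{u} A} (f g : M ⟶ N) :
    stableRel A f g ↔ StablyEq f.hom.hom g.hom.hom :=
  isProjectiveMap_iff_stablyZero (f - g)

theorem StablyIso.exists_linearMap {M N : FGModuleCat.{u} A} (h : StablyIso M N) :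
    ∃ (a : M →ₗ[A] N) (b : N →ₗ[A] M), StablyEq (b ∘ₗ a) .id ∧ StablyEq (a ∘ₗ b) .id := by
  obtain ⟨φ⟩ := h
  obtain ⟨a, ha⟩ := (Quotient.functor (stableRel A)).map_surjective φ.hom
  obtain ⟨b, hb⟩ := (Quotient.functor (stableRel A)).map_surjective φ.inv
  refine ⟨a.hom.hom, b.hom.hom, ?_, ?_⟩
  · refine (stableRel_iff_stablyEq (a ≫ b) (𝟙 M)).1 ?_
    refine (Quotient.functor_map_eq_iff (stableRel A) _ _).1 ?_
    rw [Functor.map_comp, ha, hb, φ.hom_inv_id, CategoryTheory.Functor.map_id]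
  · refine (stableRel_iff_stablyEq (b ≫ a) (𝟙 N)).1 ?_
    refine (Quotient.functor_map_eq_iff (stableRel A) _ _).1 ?_
    rw [Functor.map_comp, ha, hb, φ.inv_hom_id, CategoryTheory.Functor.map_id]

theorem stablyIso_of_linearMap {M N : Type u} [AddCommGroup M] [Module A M] [Module.Finite A M]
    [AddCommGroup N] [Module A N] [Module.Finite A N] (a : M →ₗ[A] N) (b : N →ₗ[A] M)
    (hab : StablyEq (b ∘ₗ a) .id) (hba : StablyEq (a ∘ₗ b) .id) :
    StablyIso (FGModuleCat.of A M) (FGModuleCat.of A N) := by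
  let F := Quotient.functor (stableRel A)
  refine ⟨⟨F.map (FGModuleCat.ofHom a), F.map (FGModuleCat.ofHom b), ?_, ?_⟩⟩
  · rw [← Functor.map_comp, ← CategoryTheory.Functor.map_id]
    refine (Quotient.functor_map_eq_iff (stableRel A) _ _).2 ?_
    exact (stableRel_iff_stablyEq _ _).2 hab
  · rw [← Functor.map_comp, ← CategoryTheory.Functor.map_id]
    refine (Quotient.functor_map_eq_iff (stableRel A) _ _).2 ?_
    exact (stableRel_iff_stablyEq _ _).2 hba

variable {L M N : Type u} [AddCommGroup L] [Module A L] [AddCommGroup M] [Module A M]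
  [AddCommGroup N] [Module A N]

/-- Two splittings of the same stable idempotent of `M` are stably isomorphic. -/
theorem stablyIso_of_retract [Module.Finite A L] [Module.Finite A N] {j : L →ₗ[A] M}
    {π : M →ₗ[A] L} (hπj : π ∘ₗ j = .id) {a : M →ₗ[A] N} {b : N →ₗ[A] M}
    (hab : StablyEq (a ∘ₗ b) .id) (hba : StablyEq (j ∘ₗ π) (b ∘ₗ a)) :
    StablyIso (FGModuleCat.of A L) (FGModuleCat.of A N) := by
  refine stablyIso_of_linearMap (a ∘ₗ j) (π ∘ₗ b) ?_ ?_
  · have h₁ := (StablyEq.refl π).comp (hba.symm.comp (.refl j))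
    have h₂ : π ∘ₗ (j ∘ₗ π) ∘ₗ j = .id := by
      rw [LinearMap.comp_assoc, hπj, LinearMap.comp_id, hπj]
    rw [h₂] at h₁
    exact h₁
  · have h₁ := (StablyEq.refl a).comp (hba.comp (.refl b))
    have h₂ := hab.comp hab
    rw [LinearMap.comp_id] at h₂
    exact h₁.trans h₂

theorem StablyEq.comp_self_of_comp_eq_id {a : M →ₗ[A] N} {b : N →ₗ[A] M}
    (hab : StablyEq (a ∘ₗ b) .id) : StablyEq ((b ∘ₗ a) ∘ₗ (b ∘ₗ a)) (b ∘ₗ a) :=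
  (StablyEq.refl b).comp (hab.comp (.refl a))

/-- The decomposition of a module determined by an idempotent endomorphism. -/
def idempotentEquiv {q : M →ₗ[A] M} (hq : q ∘ₗ q = q) :
    M ≃ₗ[A] LinearMap.ker (.id - q) × LinearMap.ker q :=
  have hqq (x) : q (q x) = q x := LinearMap.congr_fun hq x
  LinearEquiv.ofLinearMap
    ((q.codRestrict _ fun x => by
        rw [LinearMap.mem_ker, LinearMap.sub_apply, LinearMap.id_apply, hqq, sub_self]).prod
      ((.id - q).codRestrict _ fun x => by
        rw [LinearMap.mem_ker, LinearMap.sub_apply, LinearMap.id_apply, map_sub, hqq, sub_self]))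
    ((LinearMap.ker (.id - q)).subtype.coprod (LinearMap.ker q).subtype)
    (by
      refine LinearMap.ext fun ⟨⟨x, hx⟩, ⟨y, hy⟩⟩ => ?_
      have hx' : q x = x := by
        rw [LinearMap.mem_ker, LinearMap.sub_apply, LinearMap.id_apply, sub_eq_zero] at hx
        exact hx.symm
      have hy' : q y = 0 := hy
      refine Prod.ext (Subtype.ext ?_) (Subtype.ext ?_)
      · simp [hx', hy']
      · simp [hx', hy'])
    (by
      ext x
      simp)

theorem LiftsIdempotents.exists_decomposition {ι : Type*} {S : ι → FGModuleCat.{u} A}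
    (h : LiftsIdempotents S M) {N₁ N₂ : Type u} [AddCommGroup N₁] [Module A N₁]
    [AddCommGroup N₂] [Module A N₂] [Module.Finite A M] [Module.Finite A N₁] [Module.Finite A N₂]
    {a : M →ₗ[A] N₁ × N₂} {b : N₁ × N₂ →ₗ[A] M} (hba : StablyEq (b ∘ₗ a) .id)
    (hab : StablyEq (a ∘ₗ b) .id) :
    ∃ M₁ M₂ : FGModuleCat.{u} A, Nonempty (M ≃ₗ[A] M₁ × M₂) ∧
      (Filtrable S M₁ ∧ StablyIso M₁ (FGModuleCat.of A N₁)) ∧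
      (Filtrable S M₂ ∧ StablyIso M₂ (FGModuleCat.of A N₂)) := by
  let a₁ : M →ₗ[A] N₁ := LinearMap.fst A N₁ N₂ ∘ₗ a
  let a₂ : M →ₗ[A] N₂ := LinearMap.snd A N₁ N₂ ∘ₗ a
  let b₁ : N₁ →ₗ[A] M := b ∘ₗ LinearMap.inl A N₁ N₂
  let b₂ : N₂ →ₗ[A] M := b ∘ₗ LinearMap.inr A N₁ N₂
  have h₁ : StablyEq (a₁ ∘ₗ b₁) .id := by
    have := (StablyEq.refl (LinearMap.fst A N₁ N₂)).comp (hab.comp (.refl (LinearMap.inl A N₁ N₂)))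
    rwa [LinearMap.id_comp, LinearMap.fst_comp_inl] at this
  have h₂ : StablyEq (a₂ ∘ₗ b₂) .id := by
    have := (StablyEq.refl (LinearMap.snd A N₁ N₂)).comp (hab.comp (.refl (LinearMap.inr A N₁ N₂)))
    rwa [LinearMap.id_comp, LinearMap.snd_comp_inr] at this
  have hsum : b ∘ₗ a - b₁ ∘ₗ a₁ = b₂ ∘ₗ a₂ := by
    ext x
    simp only [a₁, a₂, b₁, b₂, LinearMap.sub_apply, LinearMap.comp_apply, ← map_sub]
    congr 1
    ext <;> simp
  obtain ⟨q, hqq, hqe, ⟨m₂, hm₂⟩, ⟨m₁, hm₁⟩⟩ := h (b₁ ∘ₗ a₁) h₁.comp_self_of_comp_eq_id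
  have hre : StablyEq (.id - q) (b₂ ∘ₗ a₂) := by
    rw [← hsum]
    exact hba.symm.sub hqe
  let e : M ≃ₗ[A] LinearMap.ker (LinearMap.id - q) × LinearMap.ker q := idempotentEquiv hqq
  have f₁ : Module.Finite A (LinearMap.ker (LinearMap.id - q)) :=
    .of_surjective (LinearMap.fst A _ (LinearMap.ker q) ∘ₗ e.toLinearMap)
      (Prod.fst_surjective.comp e.surjective)
  have f₂ : Module.Finite A (LinearMap.ker q) :=
    .of_surjective (LinearMap.snd A (LinearMap.ker (LinearMap.id - q)) _ ∘ₗ e.toLinearMap)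
      (Prod.snd_surjective.comp e.surjective)
  refine ⟨FGModuleCat.of A (LinearMap.ker (LinearMap.id - q)), FGModuleCat.of A (LinearMap.ker q),
    ⟨e⟩, ⟨hm₁.filtrable, ?_⟩, ⟨hm₂.filtrable, ?_⟩⟩
  · refine stablyIso_of_retract (j := (LinearMap.ker (LinearMap.id - q)).subtype)
      (π := LinearMap.fst A _ (LinearMap.ker q) ∘ₗ e.toLinearMap) ?_ h₁ hqe
    ext x
    have hx := LinearMap.mem_ker.1 x.2
    rw [LinearMap.sub_apply, LinearMap.id_apply, sub_eq_zero] at hx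
    exact hx.symm
  · refine stablyIso_of_retract (j := (LinearMap.ker q).subtype)
      (π := LinearMap.snd A (LinearMap.ker (LinearMap.id - q)) _ ∘ₗ e.toLinearMap) ?_ h₂ hre
    ext x
    have hx : q x = 0 := x.2
    change (x : M) - q x = x
    rw [hx, sub_zero]

end Assembly

end StableModule

open StableModule in
theorem mainTheorem11 (k : Type*) [Field k] (A : Type u) [Ring A] [Algebra k A]
    [Module.Finite k A] (hA : Module.Injective A A)
    {ι : Type*} [Finite ι] (S : ι → FGModuleCat.{u} A)
    (hS : StableModule.IsStableSimpleFamily k S)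
    (M M'₁ M'₂ : FGModuleCat.{u} A)
    (hM : StableModule.StablyIso M (StableModule.directSum M'₁ M'₂))
    (hfilt : StableModule.Filtrable S M) :
    ∃ M₁ M₂ : FGModuleCat.{u} A,
      Nonempty (M ≅ StableModule.directSum M₁ M₂) ∧
      (StableModule.Filtrable S M₁ ∧ StableModule.StablyIso M₁ M'₁) ∧
      (StableModule.Filtrable S M₂ ∧ StableModule.StablyIso M₂ M'₂) := by
  obtain ⟨n, hn⟩ := hfilt.exists_filtLength
  obtain ⟨a, b, hba, hab⟩ := hM.exists_linearMap
  obtain ⟨M₁, M₂, ⟨e⟩, h₁, h₂⟩ :=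
    (hn.liftsIdempotents hA fun _ _ => hS.exists_equiv).exists_decomposition hba hab
  exact ⟨M₁, M₂, ⟨ObjectProperty.isoMk _ e.toModuleIso⟩, h₁, h₂⟩
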